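/- A \emph{Boolean frame} is a Boolean algebra $\langle A,\sqcap,-,0\rangle$ with an arbitrary unary operation $f:A\to A$. A \emph{variety} of Boolean frames is an equational class; it is \emph{minimal} if it is nontrivial and has no proper nontrivial subvariety; it is a \emph{discriminator variety} if there is a ternary term $t$ such that on every subdirectly irreducible member $t(a,b,c)=a$ if $a\ne b$ and $t(a,b,c)=c$ if $a=b$. A variety $\mathbf V$ is \emph{strongly non-additive} (resp. \emph{strongly non-monotone}) if it is not the case that for every $(A,f)\in\mathbf V$ there is a unary operation $g$ on $A$ that is additive, i.e. $g(x\sqcup y)=g(x)\sqcup g(y)$ (resp. monotone), such that $(A,f)$ and $(A,g)$ are term-equivalent, i.e. $f$ is a term operation of $(A,g)$ and $g$ is a term operation of $(A,f)$. Let $B$ be the Boolean algebra of finite or cofinite subsets of $\mathbb N=\{0,1,\dots\}$, and let $a_n=\{n\}$, $b_n=\mathbb N\setminus\{n\}$, $u_n=\{0,\dots,n\}$. For $S\subseteq\mathbb N\setminus\{0\}$ define $f_S:B\to B$ by $f_S(\mathbb N)=b_0$, $f_S(b_n)=b_{n+1}$, $f_S(a_n)=b_n$, $f_S(u_n)=\mathbb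 N\setminus u_n$ for $n\in S$, $f_S(\emptyset)=\emptyset$, and $f_S(x)=\mathbb N$ for all other $x$ (in particular for $x=u_n$ with $1\le n\notin S$). Let $\mathfrak A_S=(B,f_S)$ and let $\mathbf V_S$ be the variety generated by $\mathfrak A_S$. A \emph{congruential modal logic} is a set $L$ of modal formulas (over countably many variables) that contains all classical tautologies and is closed under modus ponens, uniform substitution and the rule $\varphi\leftrightarrow\psi\,/\,f\varphi\leftrightarrow f\psi$; $\Gamma\vdash_L\varphi$ means that $\varphi$ is derivable from $L\cup\Gamma$ by modus ponens and this rule. $L$ is \emph{maximal} if it is maximal among the consistent congruential modal logics. $L$ has the \emph{global deduction-detachment theorem} (DDT) if there is a finite set $I(p,q)$ of formulas such that for all $\Gamma,\varphi,\psi$: $\Gamma,\varphi\vdash_L\psi$ iff $\Gamma\vdash_L\chi(\varphi,\psi)$ for all $\chi\in I$. $L$ is strongly non-additive (non-monotone) if some strongly non-additive (non-monotone) variety of Boolean frames is an equivalent algebraic semantics for $L$ in the sense of Blok and Pigozzi. \textbf{Theorem.} (1) For every $S\subseteq\mathbb N\setminus\{0\}$, $\mathbf V_S$ is a minimal discriminator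 variety that is strongly non-additive and strongly non-monotone, and the map $S\mapsto\mathbf V_S$ is injective. There are exactly $2^{\aleph_0}$ strongly non-additive minimal discriminator varieties of Boolean frames, and exactly $2^{\aleph_0}$ strongly non-monotone ones. (2) For every $S\subseteq\mathbb N\setminus\{0\}$, let $L_S$ be the set of formulas that take the value $1$ under every valuation in $\mathfrak A_S$. Then $\mathbf V_S$ is an equivalent algebraic semantics for $L_S$, and $L_S$ is a maximal congruential modal logic that has the DDT and is strongly non-additive and strongly non-monotone; the map $S\mapsto L_S$ is injective. There are exactly $2^{\aleph_0}$ strongly non-additive maximal congruential modal logics with the DDT, and exactly $2^{\aleph_0}$ strongly non-monotone ones. -/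

import Mathlib

universe u v

namespace BoolFrames

/-- Terms in the signature of Boolean frames (meet, complement, zero, and the unary operation `f`)
over a set `α` of variables. They double as formulas of modal logic. -/
inductive Tm (α : Type u) : Type u
  | var : α → Tm α
  | zero : Tm α
  | meet : Tm α → Tm α → Tm α
  | neg : Tm α → Tm α
  | op : Tm α → Tm α

namespace Tm

/-- The value of a term in the Boolean algebra `A` with `f : A → A` interpreting `op`. -/
def eval {α : Type u} {A : Type v} [BooleanAlgebra A] (f : A → A) (x : α → A) : Tm α → A
  | var i => x i
  | zero => ⊥
  | meet s t => eval f x s ⊓ eval f x t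
  | neg s => (eval f x s)ᶜ
  | op s => f (eval f x s)

/-- Simultaneous substitution. -/
def subst {α : Type u} {β : Type v} (σ : α → Tm β) : Tm α → Tm β
  | var i => σ i
  | zero => zero
  | meet s t => meet (subst σ s) (subst σ t)
  | neg s => neg (subst σ s)
  | op s => op (subst σ s)

/-- Material implication. -/
def imp {α : Type u} (s t : Tm α) : Tm α := neg (meet s (neg t))

/-- Material equivalence. -/
def iff {α : Type u} (s t : Tm α) : Tm α := meet (imp s t) (imp t s)

end Tm

/-- Formulas of modal logic: terms over countably many variables. -/
abbrev Fm : Type := Tm ℕ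

/-! ### Boolean frames and varieties -/

/-- A Boolean frame: a Boolean algebra with an arbitrary unary operation. -/
structure BFrame : Type (u + 1) where
  carrier : Type u
  [str : BooleanAlgebra carrier]
  f : carrier → carrier

attribute [instance] BFrame.str

/-- `A` satisfies the equation `s ≈ t`. -/
def BFrame.Sat (A : BFrame.{u}) (s t : Fm) : Prop :=
  ∀ x : ℕ → A.carrier, s.eval A.f x = t.eval A.f x

/-- A variety of Boolean frames: the class of all Boolean frames satisfying some set of
equations. -/
def IsVariety (V : Set BFrame.{u}) : Prop :=
  ∃ E : Set (Fm × Fm), V = {A | ∀ e ∈ E, A.Sat e.1 e.2}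

/-- The variety generated by `A`: all Boolean frames satisfying every equation true in `A`. -/
def generatedVariety (A : BFrame.{v}) : Set BFrame.{u} :=
  {B | ∀ s t : Fm, A.Sat s t → B.Sat s t}

/-- A class is nontrivial if it has a member with more than one element. -/
def IsNontrivialClass (V : Set BFrame.{u}) : Prop :=
  ∃ A ∈ V, Nontrivial A.carrier

/-- A minimal variety: nontrivial, with no proper nontrivial subvariety. -/
def IsMinimalVariety (V : Set BFrame.{u}) : Prop :=
  IsVariety V ∧ IsNontrivialClass V ∧
    ∀ W : Set BFrame.{u}, IsVariety W → W ⊆ V → IsNontrivialClass W → W = V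

/-- `θ` is a congruence of the Boolean frame `A`. -/
structure IsCongruence (A : BFrame.{u}) (θ : Setoid A.carrier) : Prop where
  meet : ∀ a b c d, θ a b → θ c d → θ (a ⊓ c) (b ⊓ d)
  compl : ∀ a b, θ a b → θ aᶜ bᶜ
  op : ∀ a b, θ a b → θ (A.f a) (A.f b)

/-- `A` is subdirectly irreducible: there is a least congruence different from equality.
(Conventions differ on the one-element algebra; nothing below depends on that.) -/
def IsSubdirectlyIrreducible (A : BFrame.{u}) : Prop :=
  ∃ μ : Setoid A.carrier, IsCongruence A μ ∧ μ ≠ ⊥ ∧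
    ∀ θ : Setoid A.carrier, IsCongruence A θ → θ ≠ ⊥ → μ ≤ θ

/-- The ternary term `t` is a discriminator term on `A`. -/
def IsDiscriminatorTerm (t : Tm (Fin 3)) (A : BFrame.{u}) : Prop :=
  ∀ a b c : A.carrier,
    (a ≠ b → t.eval A.f ![a, b, c] = a) ∧ (a = b → t.eval A.f ![a, b, c] = c)

/-- A discriminator variety: one ternary term is a discriminator term on every subdirectly
irreducible member. -/
def IsDiscriminatorVariety (V : Set BFrame.{u}) : Prop :=
  IsVariety V ∧ ∃ t : Tm (Fin 3), ∀ A ∈ V, IsSubdirectlyIrreducible A → IsDiscriminatorTerm t A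

/-! ### Strong non-additivity -/

/-- The operation `f` is definable in `(A, g)` by a term. -/
def TermDefinable {A : Type u} [BooleanAlgebra A] (f g : A → A) : Prop :=
  ∃ τ : Tm (Fin 1), ∀ a : A, f a = τ.eval g ![a]

/-- `(A, f)` and `(A, g)` are term-equivalent over the Boolean operations. -/
def TermEquivalent {A : Type u} [BooleanAlgebra A] (f g : A → A) : Prop :=
  TermDefinable f g ∧ TermDefinable g f

/-- An additive operation; `g ⊥ = ⊥` is not required. -/
def IsAdditive {A : Type u} [BooleanAlgebra A] (g : A → A) : Prop :=
  ∀ a b : A, g (a ⊔ b) = g a ⊔ g b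

/-- `V` is not equivalent to any additive variety: it is not the case that every member of `V` is
term-equivalent to some additive operation on the same Boolean algebra (the terms may depend on the
member). -/
def StronglyNonAdditive (V : Set BFrame.{u}) : Prop :=
  ¬ ∀ A ∈ V, ∃ g : A.carrier → A.carrier, IsAdditive g ∧ TermEquivalent A.f g

/-- As `StronglyNonAdditive`, with monotone in place of additive. In particular `V` is not
term-equivalent, by terms chosen uniformly, to any variety with a monotone operation. -/
def StronglyNonMonotone (V : Set BFrame.{u}) : Prop :=
  ¬ ∀ A ∈ V, ∃ g : A.carrier → A.carrier, Monotone g ∧ TermEquivalent A.f g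

/-! ### The frames on the finite-cofinite algebra -/

/-- The Boolean algebra of finite or cofinite subsets of `ℕ`. -/
def finCof : BooleanSubalgebra (Set ℕ) where
  carrier := {X | X.Finite ∨ Xᶜ.Finite}
  supClosed' := by
    rintro X hX Y hY
    simp only [Set.mem_ofPred_eq, Set.sup_eq_union, Set.compl_union] at *
    rcases hX with hX | hX
    · rcases hY with hY | hY
      · exact Or.inl (hX.union hY)
      · exact Or.inr (hY.subset Set.inter_subset_right)
    · exact Or.inr (hX.subset Set.inter_subset_left)
  infClosed' := by
    rintro X hX Y hY
    simp only [Set.mem_ofPred_eq, Set.inf_eq_inter, Set.compl_inter] at *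
    rcases hX with hX | hX
    · exact Or.inl (hX.subset Set.inter_subset_left)
    · rcases hY with hY | hY
      · exact Or.inl (hY.subset Set.inter_subset_right)
      · exact Or.inr (hX.union hY)
  compl_mem' := by
    intro X hX
    rcases hX with hX | hX
    · exact Or.inr (by simpa using hX)
    · exact Or.inl hX
  bot_mem' := Or.inl Set.finite_empty

open Classical in
/-- The operation `f_S` as a map on all subsets of `ℕ`. Here `{n}` is the atom `a_n`, `{n}ᶜ` the
co-atom `b_n`, and `Set.Iic n = {0, …, n}` is `u_n`. -/
noncomputable def opSet (S : Set ℕ) (X : Set ℕ) : Set ℕ :=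
  if X = Set.univ then {0}ᶜ
  else if h : ∃ n : ℕ, X = {n}ᶜ then {h.choose + 1}ᶜ
  else if ∃ n : ℕ, X = {n} then Xᶜ
  else if ∃ n : ℕ, 1 ≤ n ∧ n ∈ S ∧ X = Set.Iic n then Xᶜ
  else if X = ∅ then ∅
  else Set.univ

theorem opSet_mem (S X : Set ℕ) (hX : X ∈ finCof) : opSet S X ∈ finCof := by
  have hc : Xᶜ ∈ finCof := finCof.compl_mem hX
  have hs : ∀ n : ℕ, ({n}ᶜ : Set ℕ) ∈ finCof := fun n => Or.inr (by simp)
  have ht : (Set.univ : Set ℕ) ∈ finCof := Or.inr (by simp)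
  have he : (∅ : Set ℕ) ∈ finCof := Or.inl Set.finite_empty
  unfold opSet
  split_ifs
  · exact hs 0
  · exact hs _
  · exact hc
  · exact hc
  · exact he
  · exact ht

/-- The Boolean frame of the finite-cofinite algebra with the operation `f_S`. -/
noncomputable def frameOf (S : Set ℕ) : BFrame.{0} where
  carrier := finCof
  f := fun X => ⟨opSet S X.1, opSet_mem S X.1 X.2⟩

/-- The variety generated by `frameOf S`. -/
def varietyOf (S : Set ℕ) : Set BFrame.{u} := generatedVariety (frameOf S)

/-! ### Congruential modal logics -/

/-- Classical tautologies in the modal language; formulas `op s` behave as atoms. -/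
def IsTautology (φ : Fm) : Prop :=
  ∀ b : Fm → Prop, ¬ b Tm.zero → (∀ s t, b (Tm.meet s t) ↔ b s ∧ b t) →
    (∀ s, b (Tm.neg s) ↔ ¬ b s) → b φ

/-- `L` is (the set of theorems of) a congruential modal logic. -/
structure IsCongruentialLogic (L : Set Fm) : Prop where
  taut : ∀ φ, IsTautology φ → φ ∈ L
  mp : ∀ φ ψ, Tm.imp φ ψ ∈ L → φ ∈ L → ψ ∈ L
  cong : ∀ φ ψ, Tm.iff φ ψ ∈ L → Tm.iff (Tm.op φ) (Tm.op ψ) ∈ L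
  subst : ∀ (σ : ℕ → Fm) φ, φ ∈ L → Tm.subst σ φ ∈ L

/-- The (global) consequence relation of the logic with theorems `L`: derivability from theorems of
`L` and hypotheses in `Γ` by modus ponens and the congruence rule. -/
inductive Entails (L Γ : Set Fm) : Fm → Prop
  | thm (φ : Fm) : φ ∈ L → Entails L Γ φ
  | hyp (φ : Fm) : φ ∈ Γ → Entails L Γ φ
  | mp (φ ψ : Fm) : Entails L Γ (Tm.imp φ ψ) → Entails L Γ φ → Entails L Γ ψ
  | cong (φ ψ : Fm) : Entails L Γ (Tm.iff φ ψ) → Entails L Γ (Tm.iff (Tm.op φ) (Tm.op ψ))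

/-- `L` is maximal among the consistent congruential modal logics. -/
def IsMaximalLogic (L : Set Fm) : Prop :=
  IsCongruentialLogic L ∧ Tm.zero ∉ L ∧
    ∀ L' : Set Fm, IsCongruentialLogic L' → Tm.zero ∉ L' → L ⊆ L' → L' = L

/-- The global deduction-detachment theorem: for some finite set `I(p, q)` of formulas in two
variables, `Γ, φ ⊢ ψ` iff `Γ ⊢ I(φ, ψ)`. -/
def HasDDT (L : Set Fm) : Prop :=
  ∃ I : Finset (Tm (Fin 2)), ∀ (Γ : Set Fm) (φ ψ : Fm),
    Entails L (insert φ Γ) ψ ↔ ∀ χ ∈ I, Entails L Γ (χ.subst ![φ, ψ])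

/-- Equational consequence relative to the class `V`. -/
def EqEntails (V : Set BFrame.{u}) (E : Set (Fm × Fm)) (e : Fm × Fm) : Prop :=
  ∀ A ∈ V, ∀ x : ℕ → A.carrier,
    (∀ d ∈ E, d.1.eval A.f x = d.2.eval A.f x) → e.1.eval A.f x = e.2.eval A.f x

/-- The equations `τ(φ)`, for `φ ∈ Γ`, obtained from a set `τ` of equations in one variable. -/
def transform (τ : Finset (Tm (Fin 1) × Tm (Fin 1))) (Γ : Set Fm) : Set (Fm × Fm) :=
  {e | ∃ φ ∈ Γ, ∃ d ∈ τ, e = (d.1.subst ![φ], d.2.subst ![φ])}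

/-- `V` is an equivalent algebraic semantics for the logic `L` (in the sense of Blok and Pigozzi),
with defining equations `τ` and equivalence formulas `Δ`. -/
def IsEquivalentAlgebraicSemantics (L : Set Fm) (V : Set BFrame.{u}) : Prop :=
  ∃ (τ : Finset (Tm (Fin 1) × Tm (Fin 1))) (Δ : Finset (Tm (Fin 2))),
    (∀ (Γ : Set Fm) (φ : Fm),
      Entails L Γ φ ↔ ∀ e ∈ transform τ {φ}, EqEntails V (transform τ Γ) e) ∧
    ∀ s t : Fm,
      (∀ e ∈ transform τ {φ | ∃ δ ∈ Δ, φ = δ.subst ![s, t]}, EqEntails V {(s, t)} e) ∧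
      EqEntails V (transform τ {φ | ∃ δ ∈ Δ, φ = δ.subst ![s, t]}) (s, t)

/-- A logic is strongly non-additive if it is algebraized by a strongly non-additive variety. -/
def IsStronglyNonAdditiveLogic (L : Set Fm) : Prop :=
  ∃ V : Set BFrame.{u}, IsVariety V ∧ IsEquivalentAlgebraicSemantics L V ∧ StronglyNonAdditive V

/-- A logic is strongly non-monotone if it is algebraized by a strongly non-monotone variety. -/
def IsStronglyNonMonotoneLogic (L : Set Fm) : Prop :=
  ∃ V : Set BFrame.{u}, IsVariety V ∧ IsEquivalentAlgebraicSemantics L V ∧ StronglyNonMonotone V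

/-- The logic of `frameOf S`: the formulas that always take the value `1` in it. -/
def logicOf (S : Set ℕ) : Set Fm :=
  {φ | (frameOf S).Sat φ (Tm.neg Tm.zero)}

end BoolFrames

/-!
In `𝔄_S` the term `d x = x ⊔ f x` is `⊥` at `⊥` and `⊤` everywhere else (`IsSwitching`), and every
element is the value of a closed term (`IsTermGenerated`): the co-atoms are the iterates of `f` at
`⊤`, and Boolean combinations of them give all finite and cofinite sets. Apart from
injectivity and the cardinalities, everything follows from these two properties and from `f ⊤ = b_0`
being neither `⊥` nor `⊤`.

* An equation that fails in `𝔄_S` fails for closed terms `s`, `t`, and then the closed equation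
  `d (s ⊕ t) ≈ 1` holds throughout `𝐕_S`. In a member satisfying the original equation this reads
  `0 ≈ 1`. So a proper subvariety is trivial, with no appeal to Jónsson's lemma. The same argument
  shows that adding a formula to `L_S` gives an inconsistent logic
  (`isMinimalVariety_generatedVariety`, `BFrame.isMaximalLogic_logic`).
* In every member of `𝐕_S` the elements `d a` and `- d a` induce complementary factor congruences;
  on a subdirectly irreducible member one of these is trivial, so `d` still switches there and
  `(x ⊓ d (x ⊕ y)) ⊔ (z ⊓ - d (x ⊕ y))` is a discriminator term
  (`BFrame.IsSwitching.of_isSubdirectlyIrreducible`).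
* Let `f` be definable from a monotone `g` in a switching frame. Every value of `g` lies between
  `g ⊥` and `g ⊤`, so equality below `g ⊥`, or below `- g ⊤`, is a congruence for `g` and hence for
  `f`. A switching frame has no such congruence other than the two trivial ones, so `g ⊥` and `g ⊤`
  both lie in `{⊥, ⊤}`. Then `{⊥, ⊤}` is closed under `g`, hence under `f`, which contradicts
  `f ⊤ = b_0` (`BFrame.IsSwitching.not_termDefinable_of_monotone`). Additive operations are monotone.
* For `n ≥ 1` the closed equation `f u_n ≈ - u_n` holds in `𝔄_S` exactly if `n ∈ S`
  (`exists_sat_iff_mem`). This gives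
  injectivity of `S ↦ 𝐕_S` and `S ↦ L_S`, hence the lower bounds on the cardinalities; the upper
  bounds hold because there are only countably many formulas.
* Completeness of `L_S` with respect to `𝐕_S` is shown by Lindenbaum algebras, which lie in `𝐕_S`
  (`BFrame.entails_iff`).
  The deduction theorem holds with the formula `□ p → q`, where `□ p = - d (- p)`.
-/

namespace BoolFrames

/-! ### Derived connectives and evaluation -/

namespace Tm

variable {α : Type u} {β : Type*} {A : Type v} [BooleanAlgebra A]

/-- Disjunction. -/
def sup (s t : Tm α) : Tm α := neg (meet (neg s) (neg t))

/-- The term `s ⊔ f s`, written `d s` in comments. On the frames of interest it is `⊥` when `s` is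
`⊥` and `⊤` otherwise. -/
def sw (s : Tm α) : Tm α := sup s (op s)

/-- The term `- d (- s)`: on the frames of interest it is `⊤` when `s` is `⊤` and `⊥` otherwise. -/
def box (s : Tm α) : Tm α := neg (sw (neg s))

theorem eval_sup (f : A → A) (x : α → A) (s t : Tm α) :
    (sup s t).eval f x = s.eval f x ⊔ t.eval f x := by
  simp [sup, eval]

theorem eval_sw (f : A → A) (x : α → A) (s : Tm α) :
    (sw s).eval f x = s.eval f x ⊔ f (s.eval f x) := by
  simp [sw, eval_sup, eval]

theorem eval_imp_eq_top (f : A → A) (x : α → A) (s t : Tm α) :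
    (imp s t).eval f x = ⊤ ↔ s.eval f x ≤ t.eval f x := by
  simp only [imp, eval, compl_eq_top, ← disjoint_iff, disjoint_compl_right_iff]

theorem eval_iff_eq_top (f : A → A) (x : α → A) (s t : Tm α) :
    (iff s t).eval f x = ⊤ ↔ s.eval f x = t.eval f x := by
  rw [iff, eval, inf_eq_top_iff, eval_imp_eq_top, eval_imp_eq_top, le_antisymm_iff]

theorem eval_subst (f : A → A) (σ : α → Tm β) (x : β → A) (s : Tm α) :
    (s.subst σ).eval f x = s.eval f (fun i => (σ i).eval f x) := by
  induction s with
  | var i => rfl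
  | zero => rfl
  | meet s t hs ht => simp only [subst, eval, hs, ht]
  | neg s hs => simp only [subst, eval, hs]
  | op s hs => simp only [subst, eval, hs]

theorem subst_var (s : Tm α) : s.subst Tm.var = s := by
  induction s with
  | var i => rfl
  | zero => rfl
  | meet s t hs ht => simp only [Tm.subst, hs, ht]
  | neg s hs => simp only [Tm.subst, hs]
  | op s hs => simp only [Tm.subst, hs]

/-- A Gödel numbering, from a numbering of the variables: the residue modulo 5 records the outermost
constructor. -/
def code (e : α → ℕ) : Tm α → ℕ
  | var i => 5 * e i
  | zero => 1
  | meet s t => 5 * Nat.pair (code e s) (code e t) + 2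
  | neg s => 5 * code e s + 3
  | op s => 5 * code e s + 4

theorem code_injective {e : α → ℕ} (he : Function.Injective e) : Function.Injective (code e) := by
  intro s
  induction s with
  | var i =>
    rintro (j | _ | ⟨p, q⟩ | p | p) h <;> simp only [code] at h <;> try omega
    rw [he (by omega : e i = e j)]
  | zero => rintro (j | _ | ⟨p, q⟩ | p | p) h <;> simp only [code] at h <;> first | rfl | omega
  | meet s t hs ht =>
    rintro (j | _ | ⟨p, q⟩ | p | p) h <;> simp only [code] at h <;> try omega
    obtain ⟨h1, h2⟩ := Nat.pair_eq_pair.1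
      (by omega : Nat.pair (code e s) (code e t) = Nat.pair (code e p) (code e q))
    rw [hs h1, ht h2]
  | neg s hs =>
    rintro (j | _ | ⟨p, q⟩ | p | p) h <;> simp only [code] at h <;> try omega
    rw [hs (by omega : code e s = code e p)]
  | op s hs =>
    rintro (j | _ | ⟨p, q⟩ | p | p) h <;> simp only [code] at h <;> try omega
    rw [hs (by omega : code e s = code e p)]

instance countable [Countable α] : Countable (Tm α) :=
  let ⟨_, he⟩ := exists_injective_nat α
  (code_injective he).countable

end Tm

/-! ### Lifting frames to a larger universe -/

/-- The copy of a Boolean frame in a larger universe. -/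
def BFrame.ulift (A : BFrame.{v}) : BFrame.{max u v} where
  carrier := ULift.{u} A.carrier
  str :=
    { (inferInstance : DistribLattice (ULift.{u} A.carrier)) with
      compl := fun a => ⟨a.downᶜ⟩
      top := ⟨⊤⟩
      bot := ⟨⊥⟩
      sdiff := fun a b => ⟨a.down ⊓ b.downᶜ⟩
      himp := fun a b => ⟨b.down ⊔ a.downᶜ⟩
      sdiff_eq := fun _ _ => rfl
      himp_eq := fun _ _ => rfl
      inf_compl_le_bot := fun a => BooleanAlgebra.inf_compl_le_bot a.down
      top_le_sup_compl := fun a => BooleanAlgebra.top_le_sup_compl a.down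
      le_top := fun a => le_top (a := a.down)
      bot_le := fun a => bot_le (a := a.down) }
  f := fun a => ⟨A.f a.down⟩

theorem BFrame.down_eval_ulift (A : BFrame.{v}) {α : Type*} (x : α → (ulift.{u} A).carrier)
    (s : Tm α) : (s.eval (ulift.{u} A).f x).down = s.eval A.f (fun i => (x i).down) := by
  induction s with
  | var i => rfl
  | zero => rfl
  | meet s t hs ht => simp only [Tm.eval, ← hs, ← ht]; rfl
  | neg s hs => simp only [Tm.eval, ← hs]; rfl
  | op s hs => simp only [Tm.eval, ← hs]; rfl

theorem BFrame.sat_ulift (A : BFrame.{v}) (s t : Fm) : (ulift.{u} A).Sat s t ↔ A.Sat s t := by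
  constructor
  · intro h x
    exact (A.down_eval_ulift _ s).symm.trans
      ((congrArg ULift.down (h fun i => ⟨x i⟩)).trans (A.down_eval_ulift _ t))
  · intro h x
    apply ULift.down_injective
    rw [down_eval_ulift, down_eval_ulift, h]

theorem BFrame.ulift_mem_generatedVariety (A : BFrame.{v}) :
    ulift.{u} A ∈ generatedVariety.{max u v} A :=
  fun s t h => (A.sat_ulift s t).2 h

/-! ### Switching frames -/

/-- A frame in which `d x = x ⊔ f x` is `⊥` at `⊥` and `⊤` elsewhere. -/
structure BFrame.IsSwitching (A : BFrame.{u}) : Prop where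
  op_bot : A.f ⊥ = ⊥
  sup_op : ∀ x, x ≠ ⊥ → x ⊔ A.f x = ⊤

/-- Every element is the value of a closed term. -/
def BFrame.IsTermGenerated (A : BFrame.{u}) : Prop :=
  ∀ a : A.carrier, ∃ c : Tm Empty, c.eval A.f Empty.elim = a

theorem BFrame.IsSwitching.sw_eq {A : BFrame.{u}} (h : A.IsSwitching) (a : A.carrier) :
    a ⊔ A.f a = ⊥ ∨ a ⊔ A.f a = ⊤ := by
  by_cases ha : a = ⊥
  · exact Or.inl (by rw [ha, h.op_bot, sup_idem])
  · exact Or.inr (h.sup_op a ha)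

theorem BFrame.IsSwitching.ulift {A : BFrame.{v}} (h : A.IsSwitching) :
    (BFrame.ulift.{u} A).IsSwitching where
  op_bot := congrArg ULift.up h.op_bot
  sup_op := fun x hx => congrArg ULift.up (h.sup_op x.down fun e => hx (congrArg ULift.up e))

/-- Value assignments into a term-generated frame are instances by closed terms. -/
theorem BFrame.IsTermGenerated.exists_subst {A : BFrame.{u}} (h : A.IsTermGenerated)
    {α : Type*} (x : α → A.carrier) :
    ∃ σ : α → Tm Empty, ∀ s : Tm α, (s.subst σ).eval A.f Empty.elim = s.eval A.f x := by
  choose c hc using h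
  exact ⟨fun i => c (x i), fun s => by simp only [Tm.eval_subst, hc]⟩

/-- A closed formula, seen as a formula. -/
def Tm.ofClosed (c : Tm Empty) : Fm := c.subst Empty.elim

theorem Tm.eval_ofClosed {A : Type v} [BooleanAlgebra A] (f : A → A) (x : ℕ → A) (c : Tm Empty) :
    c.ofClosed.eval f x = c.eval f Empty.elim := by
  rw [ofClosed, eval_subst]
  congr 1
  funext i
  exact i.elim

/-! ### The generated variety -/

theorem isVariety_generatedVariety (A : BFrame.{v}) : IsVariety (generatedVariety.{u} A) :=
  ⟨{e | A.Sat e.1 e.2}, by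
    ext B
    exact ⟨fun h e he => h _ _ he, fun h s t hst => h (s, t) hst⟩⟩

/-- An equation that fails in a term-generated switching frame `A` fails for some closed terms; with
`d` this becomes a closed equation true in `A` that trivializes any member of the variety satisfying
the original one. -/
theorem isMinimalVariety_generatedVariety {A : BFrame.{v}} [Nontrivial A.carrier]
    (hs : A.IsSwitching) (hg : A.IsTermGenerated) :
    IsMinimalVariety (generatedVariety.{max u v} A) := by
  refine ⟨isVariety_generatedVariety A,
    ⟨A.ulift, A.ulift_mem_generatedVariety, inferInstanceAs (Nontrivial (ULift A.carrier))⟩, ?_⟩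
  rintro W ⟨E, rfl⟩ hW ⟨B, hB, hBn⟩
  refine hW.antisymm fun C hC e he => hC _ _ fun x => ?_
  by_contra hne
  obtain ⟨σ, hσ⟩ := hg.exists_subst x
  let s : Tm Empty := e.1.subst σ
  let t : Tm Empty := e.2.subst σ
  -- `sw (neg (iff s t))` is `⊤` in `A`, where the values of `s` and `t` differ, and `⊥` in `B`
  have h1 : B.Sat (Tm.sw (Tm.neg (Tm.iff s t))).ofClosed (Tm.neg Tm.zero) := hW hB _ _ fun y => by
    rw [Tm.eval_ofClosed, Tm.eval_sw]
    simp only [Tm.eval, compl_bot]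
    refine hs.sup_op _ fun h => hne ?_
    replace h := (Tm.eval_iff_eq_top _ _ _ _).1 (compl_eq_bot.1 h)
    rwa [hσ, hσ] at h
  have h2 : B.Sat (Tm.op Tm.zero) Tm.zero := hW hB _ _ fun y => hs.op_bot
  have h3 := h1 fun _ => ⊥
  have h4 : B.f ⊥ = ⊥ := h2 fun _ => ⊥
  have h5 : (Tm.iff s t).eval B.f Empty.elim = ⊤ := by
    rw [Tm.eval_iff_eq_top]
    have hy : (fun i => (σ i).ofClosed.eval B.f fun _ => ⊥)
        = fun i => (σ i).eval B.f Empty.elim := funext fun i => Tm.eval_ofClosed _ _ _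
    have := hB e he fun i => (σ i).ofClosed.eval B.f fun _ => ⊥
    rw [hy] at this
    simpa only [s, t, Tm.eval_subst] using this
  rw [Tm.eval_ofClosed, Tm.eval_sw] at h3
  simp only [Tm.eval, h5, compl_top, h4, sup_idem, compl_bot] at h3
  exact bot_ne_top h3

/-! ### Discriminator terms -/

/-- The discriminator term `(x ⊓ d (x ⊕ y)) ⊔ (z ⊓ - d (x ⊕ y))`. -/
def discr : Tm (Fin 3) :=
  let x := Tm.var 0
  let y := Tm.var 1
  let z := Tm.var 2
  let e := Tm.sw (Tm.neg (Tm.iff x y))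
  Tm.sup (Tm.meet x e) (Tm.meet z (Tm.neg e))

theorem BFrame.IsSwitching.isDiscriminatorTerm {A : BFrame.{u}} (h : A.IsSwitching) :
    IsDiscriminatorTerm discr A := by
  intro a b c
  have key := Tm.eval_iff_eq_top A.f ![a, b, c] (Tm.var 0) (Tm.var 1)
  simp only [discr, Tm.eval_sup, Tm.eval, Tm.eval_sw]
  simp only [Tm.eval, Matrix.cons_val_zero, Matrix.cons_val_one, Matrix.cons_val] at key ⊢
  constructor
  · intro hab
    rw [h.sup_op _ fun e => hab (key.1 (compl_eq_bot.1 e))]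
    simp
  · intro hab
    rw [key.2 hab, compl_top, h.op_bot]
    simp

/-- The relation "equal below `c`". -/
def eqBelow {A : Type u} [BooleanAlgebra A] (c : A) : Setoid A where
  r x y := x ⊓ c = y ⊓ c
  iseqv := ⟨fun _ => rfl, fun h => h.symm, fun h h' => h.trans h'⟩

theorem eqBelow_meet {A : Type u} [BooleanAlgebra A] {c x y z w : A} (h : eqBelow c x y)
    (h' : eqBelow c z w) : eqBelow c (x ⊓ z) (y ⊓ w) := by
  change (x ⊓ z) ⊓ c = (y ⊓ w) ⊓ c
  rw [inf_inf_distrib_right, show x ⊓ c = y ⊓ c from h, show z ⊓ c = w ⊓ c from h',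
    ← inf_inf_distrib_right]

theorem eqBelow_compl {A : Type u} [BooleanAlgebra A] {c x y : A} (h : eqBelow c x y) :
    eqBelow c xᶜ yᶜ := by
  have e : ∀ z : A, zᶜ ⊓ c = c \ (z ⊓ c) := fun z => by
    rw [sdiff_inf_self_right, sdiff_eq, inf_comm]
  change xᶜ ⊓ c = yᶜ ⊓ c
  rw [e, e, show x ⊓ c = y ⊓ c from h]

theorem isCongruence_eqBelow {A : BFrame.{u}} {c : A.carrier}
    (h : ∀ x, A.f x ⊓ c = A.f (x ⊓ c) ⊓ c) : IsCongruence A (eqBelow c) where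
  meet _ _ _ _ := eqBelow_meet
  compl _ _ := eqBelow_compl
  op a b hab := by
    change A.f a ⊓ c = A.f b ⊓ c
    rw [h a, h b, show a ⊓ c = b ⊓ c from hab]

theorem eq_top_of_eqBelow_eq_bot {A : Type u} [BooleanAlgebra A] {c : A} (h : eqBelow c = ⊥) :
    c = ⊤ := by
  have : eqBelow c cᶜ ⊥ := by change cᶜ ⊓ c = ⊥ ⊓ c; simp
  rw [h] at this
  exact compl_eq_bot.1 this

/-- In the variety of a switching frame, "equal below `d a`" and "equal below `- d a`" are
complementary congruences; on a subdirectly irreducible member one of them is trivial, so that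
`d a` is `⊥` or `⊤`. -/
theorem BFrame.IsSwitching.of_isSubdirectlyIrreducible {A : BFrame.{v}} (h : A.IsSwitching)
    {B : BFrame.{u}} (hB : B ∈ generatedVariety A) (hsi : IsSubdirectlyIrreducible B) :
    B.IsSwitching := by
  let a : Fm := Tm.var 0
  let x : Fm := Tm.var 1
  have h0 : B.Sat (Tm.op Tm.zero) Tm.zero := hB _ _ fun _ => h.op_bot
  have e1 : B.Sat (Tm.meet (Tm.op x) (Tm.sw a))
      (Tm.meet (Tm.op (Tm.meet x (Tm.sw a))) (Tm.sw a)) := hB _ _ fun y => by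
    simp only [Tm.eval, Tm.eval_sw]
    rcases h.sw_eq (a.eval A.f y) with e | e <;> rw [e] <;> simp
  have e2 : B.Sat (Tm.meet (Tm.op x) (Tm.neg (Tm.sw a)))
      (Tm.meet (Tm.op (Tm.meet x (Tm.neg (Tm.sw a)))) (Tm.neg (Tm.sw a))) := hB _ _ fun y => by
    simp only [Tm.eval, Tm.eval_sw]
    rcases h.sw_eq (a.eval A.f y) with e | e <;> rw [e] <;> simp
  refine ⟨h0 fun _ => ⊥, fun b hb => ?_⟩
  have c1 : IsCongruence B (eqBelow (b ⊔ B.f b)) := isCongruence_eqBelow fun y => by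
    simpa [a, x, Tm.eval, Tm.eval_sw] using e1 fun i => if i = 0 then b else y
  have c2 : IsCongruence B (eqBelow (b ⊔ B.f b)ᶜ) := isCongruence_eqBelow fun y => by
    simpa [a, x, Tm.eval, Tm.eval_sw] using e2 fun i => if i = 0 then b else y
  obtain ⟨μ, -, hμ, hleast⟩ := hsi
  by_contra hne
  refine hμ (le_bot_iff.1 fun y z hyz => ?_)
  have l1 : y ⊓ (b ⊔ B.f b) = z ⊓ (b ⊔ B.f b) :=
    hleast _ c1 (fun e => hne (eq_top_of_eqBelow_eq_bot e)) hyz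
  have l2 : y ⊓ (b ⊔ B.f b)ᶜ = z ⊓ (b ⊔ B.f b)ᶜ :=
    hleast _ c2 (fun e => hb (le_bot_iff.1 (le_sup_left.trans
      (compl_eq_top.1 (eq_top_of_eqBelow_eq_bot e)).le))) hyz
  change y = z
  calc y = y ⊓ (b ⊔ B.f b) ⊔ y ⊓ (b ⊔ B.f b)ᶜ := sup_inf_inf_compl.symm
    _ = z := by rw [l1, l2, sup_inf_inf_compl]

theorem BFrame.IsSwitching.isDiscriminatorVariety {A : BFrame.{v}} (h : A.IsSwitching) :
    IsDiscriminatorVariety (generatedVariety.{u} A) :=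
  ⟨isVariety_generatedVariety A, discr, fun _ hB hsi =>
    (h.of_isSubdirectlyIrreducible hB hsi).isDiscriminatorTerm⟩

/-! ### Monotone operations -/

theorem eqBelow_eval {A : Type u} [BooleanAlgebra A] {g : A → A} {c : A}
    (hg : ∀ x y, eqBelow c x y → eqBelow c (g x) (g y)) {α : Type*} {x y : α → A}
    (h : ∀ i, eqBelow c (x i) (y i)) (s : Tm α) : eqBelow c (s.eval g x) (s.eval g y) := by
  induction s with
  | var i => exact h i
  | zero => exact (eqBelow c).refl _
  | meet s t hs ht => exact eqBelow_meet hs ht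
  | neg s hs => exact eqBelow_compl hs
  | op s hs => exact hg _ _ hs

/-- If `g` is constant below `c`, then "equal below `c`" is a congruence of `(A, g)`, hence of every
frame term-definable from it; and a switching frame has no nontrivial such congruence. -/
theorem BFrame.IsSwitching.eq_bot_or_eq_top {A : BFrame.{u}} (h : A.IsSwitching)
    {g : A.carrier → A.carrier} (hd : TermDefinable A.f g) {c : A.carrier}
    (hc : ∀ x y, g x ⊓ c = g y ⊓ c) : c = ⊥ ∨ c = ⊤ := by
  obtain ⟨τ, hτ⟩ := hd
  by_contra! hne
  have h1 : eqBelow c (A.f ⊥) (A.f cᶜ) := by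
    rw [hτ, hτ]
    refine eqBelow_eval (fun x y _ => hc x y) (fun i => ?_) τ
    rw [Subsingleton.elim i 0]
    change ⊥ ⊓ c = cᶜ ⊓ c
    simp
  have h2 : Disjoint (A.f cᶜ) c := by
    rw [disjoint_iff, ← show A.f ⊥ ⊓ c = A.f cᶜ ⊓ c from h1, h.op_bot, bot_inf_eq]
  have h3 := h.sup_op cᶜ fun e => hne.2 (compl_eq_bot.1 e)
  rw [sup_eq_left.2 h2.le_compl_right] at h3
  exact hne.1 (compl_eq_top.1 h3)

theorem eval_eq_bot_or_eq_top {A : Type u} [BooleanAlgebra A] {g : A → A}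
    (hb : g ⊥ = ⊥ ∨ g ⊥ = ⊤) (ht : g ⊤ = ⊥ ∨ g ⊤ = ⊤) {α : Type*} {x : α → A}
    (hx : ∀ i, x i = ⊥ ∨ x i = ⊤) (s : Tm α) : s.eval g x = ⊥ ∨ s.eval g x = ⊤ := by
  induction s with
  | var i => exact hx i
  | zero => exact Or.inl rfl
  | meet s t hs ht => rcases hs with hs | hs <;> rcases ht with ht | ht <;> simp [Tm.eval, hs, ht]
  | neg s hs => rcases hs with hs | hs <;> simp [Tm.eval, hs]
  | op s hs => rcases hs with hs | hs <;> simpa only [Tm.eval, hs]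

/-- A monotone `g` is constant below `(g ⊤)ᶜ` and below `g ⊥`; so both `g ⊤` and `g ⊥` are `⊥` or
`⊤`, whence `{⊥, ⊤}` is closed under every operation term-definable from `g`. -/
theorem BFrame.IsSwitching.not_termDefinable_of_monotone {A : BFrame.{u}} (h : A.IsSwitching)
    (h0 : A.f ⊤ ≠ ⊥) (h1 : A.f ⊤ ≠ ⊤) {g : A.carrier → A.carrier} (hg : Monotone g) :
    ¬ TermDefinable A.f g := by
  intro hd
  have ht : (g ⊤)ᶜ = ⊥ ∨ (g ⊤)ᶜ = ⊤ := h.eq_bot_or_eq_top hd fun x y => by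
    have e : ∀ z, g z ⊓ (g ⊤)ᶜ = ⊥ := fun z =>
      (disjoint_compl_right_iff.2 (hg le_top)).eq_bot
    rw [e, e]
  have hb : g ⊥ = ⊥ ∨ g ⊥ = ⊤ := h.eq_bot_or_eq_top hd fun x y => by
    rw [inf_eq_right.2 (hg bot_le), inf_eq_right.2 (hg bot_le)]
  obtain ⟨τ, hτ⟩ := hd
  have := eval_eq_bot_or_eq_top hb (by simpa [or_comm] using ht)
    (x := ![(⊤ : A.carrier)]) (fun i => Or.inr (by simp)) τ
  rw [← hτ] at this
  exact this.elim h0 h1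

theorem BFrame.IsSwitching.stronglyNonMonotone {A : BFrame.{v}} (h : A.IsSwitching)
    (h0 : A.f ⊤ ≠ ⊥) (h1 : A.f ⊤ ≠ ⊤) : StronglyNonMonotone (generatedVariety.{max u v} A) := by
  intro hall
  obtain ⟨g, hg, hd, -⟩ := hall _ A.ulift_mem_generatedVariety
  exact h.ulift.not_termDefinable_of_monotone (fun e => h0 (congrArg ULift.down e))
    (fun e => h1 (congrArg ULift.down e)) hg hd

theorem IsAdditive.monotone {A : Type u} [BooleanAlgebra A] {g : A → A} (h : IsAdditive g) :
    Monotone g := fun a b hab => by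
  rw [← sup_eq_right.2 hab, h]
  exact le_sup_left

theorem StronglyNonMonotone.stronglyNonAdditive {V : Set BFrame.{u}} (h : StronglyNonMonotone V) :
    StronglyNonAdditive V := fun hall => h fun A hA =>
  let ⟨g, hg, ht⟩ := hall A hA
  ⟨g, hg.monotone, ht⟩

/-! ### Derivability in a congruential logic -/

/-- Boolean valuations of modal formulas, with formulas `op s` treated as atoms. -/
structure IsBoolVal (b : Fm → Prop) : Prop where
  zero : ¬ b Tm.zero
  meet : ∀ s t, b (Tm.meet s t) ↔ b s ∧ b t
  neg : ∀ s, b (Tm.neg s) ↔ ¬ b s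

namespace IsBoolVal

variable {b : Fm → Prop}

theorem imp (h : IsBoolVal b) (s t : Fm) : b (Tm.imp s t) ↔ (b s → b t) := by
  simp only [Tm.imp, h.meet, h.neg, not_and, not_not]

theorem iff (h : IsBoolVal b) (s t : Fm) : b (Tm.iff s t) ↔ (b s ↔ b t) := by
  rw [Tm.iff, h.meet, h.imp, h.imp]
  exact iff_iff_implies_and_implies.symm

theorem sup (h : IsBoolVal b) (s t : Fm) : b (Tm.sup s t) ↔ b s ∨ b t := by
  simp only [Tm.sup, h.meet, h.neg, not_and_or, not_not]

end IsBoolVal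

section Entails

variable {L Γ Δ : Set Fm}

theorem IsCongruentialLogic.taut_mem (hL : IsCongruentialLogic L) {φ : Fm}
    (h : ∀ b, IsBoolVal b → b φ) : φ ∈ L :=
  hL.taut φ fun b h0 h1 h2 => h b ⟨h0, h1, h2⟩

theorem Entails.taut (hL : IsCongruentialLogic L) {φ : Fm} (h : ∀ b, IsBoolVal b → b φ) :
    Entails L Γ φ :=
  .thm _ (hL.taut_mem h)

theorem Entails.taut₁ (hL : IsCongruentialLogic L) {φ χ : Fm} (hφ : Entails L Γ φ)
    (h : ∀ b, IsBoolVal b → b φ → b χ) : Entails L Γ χ :=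
  .mp φ _ (.taut hL fun b hb => (hb.imp _ _).2 (h b hb)) hφ

theorem Entails.taut₂ (hL : IsCongruentialLogic L) {φ ψ χ : Fm} (hφ : Entails L Γ φ)
    (hψ : Entails L Γ ψ) (h : ∀ b, IsBoolVal b → b φ → b ψ → b χ) : Entails L Γ χ :=
  .mp ψ _ (hφ.taut₁ hL fun b hb h1 => (hb.imp _ _).2 (h b hb h1)) hψ

theorem Entails.mono (h : Γ ⊆ Δ) {φ : Fm} (hφ : Entails L Γ φ) : Entails L Δ φ := by
  induction hφ with
  | thm φ hφ => exact .thm φ hφ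
  | hyp φ hφ => exact .hyp φ (h hφ)
  | mp φ ψ _ _ h1 h2 => exact .mp φ ψ h1 h2
  | cong φ ψ _ h1 => exact .cong φ ψ h1

theorem entails_empty_iff (hL : IsCongruentialLogic L) {φ : Fm} : Entails L ∅ φ ↔ φ ∈ L := by
  refine ⟨fun h => ?_, .thm φ⟩
  induction h with
  | thm φ hφ => exact hφ
  | hyp φ hφ => exact hφ.elim
  | mp φ ψ _ _ h1 h2 => exact hL.mp φ ψ h1 h2
  | cong φ ψ _ h1 => exact hL.cong φ ψ h1

end Entails

/-! ### The Lindenbaum algebra -/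

/-- Provable equivalence of formulas from the hypotheses `Γ`. -/
def provEquiv {L : Set Fm} (hL : IsCongruentialLogic L) (Γ : Set Fm) : Setoid Fm where
  r s t := Entails L Γ (Tm.iff s t)
  iseqv := ⟨fun s => .taut hL fun b hb => by rw [hb.iff],
    fun h => h.taut₁ hL fun b hb h => by rw [hb.iff] at h ⊢; exact h.symm,
    fun h h' => h.taut₂ hL h' fun b hb h h' => by
      rw [hb.iff] at h h' ⊢; exact h.trans h'⟩

/-- The Lindenbaum algebra of the logic `L` with hypotheses `Γ`, as a Boolean frame. -/
def lindenbaum {L : Set Fm} (hL : IsCongruentialLogic L) (Γ : Set Fm) : BFrame.{0} where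
  carrier := Quotient (provEquiv hL Γ)
  f := Quotient.map Tm.op fun s t h => Entails.cong s t h
  str :=
    { le := Quotient.lift₂ (fun s t => Entails L Γ (Tm.imp s t)) fun s t s' t' h h' => propext
        ⟨fun e => .taut₂ hL (.taut₂ hL h h' (χ := Tm.meet (Tm.iff s s') (Tm.iff t t'))
            fun b hb h h' => (hb.meet _ _).2 ⟨h, h'⟩) e fun b hb => by
              simp only [hb.meet, hb.iff, hb.imp]; tauto,
          fun e => .taut₂ hL (.taut₂ hL h h' (χ := Tm.meet (Tm.iff s s') (Tm.iff t t'))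
            fun b hb h h' => (hb.meet _ _).2 ⟨h, h'⟩) e fun b hb => by
              simp only [hb.meet, hb.iff, hb.imp]; tauto⟩
      inf := Quotient.map₂ Tm.meet fun s s' h t t' h' => .taut₂ hL h h' fun b hb => by
        simp only [hb.meet, hb.iff]; tauto
      sup := Quotient.map₂ Tm.sup fun s s' h t t' h' => .taut₂ hL h h' fun b hb => by
        simp only [hb.sup, hb.iff]; tauto
      compl := Quotient.map Tm.neg fun s s' h => .taut₁ hL h fun b hb => by
        simp only [hb.neg, hb.iff]; tauto
      top := ⟦Tm.neg Tm.zero⟧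
      bot := ⟦Tm.zero⟧
      le_refl := by
        rintro ⟨s⟩
        exact .taut hL fun b hb => by simp only [hb.imp]; tauto
      le_trans := by
        rintro ⟨s⟩ ⟨t⟩ ⟨r⟩ h h'
        exact .taut₂ hL h h' fun b hb => by simp only [hb.imp]; tauto
      le_antisymm := by
        rintro ⟨s⟩ ⟨t⟩ h h'
        exact Quotient.sound (.taut₂ hL h h' fun b hb => by simp only [hb.imp, hb.iff]; tauto)
      le_sup_left := by
        rintro ⟨s⟩ ⟨t⟩
        exact .taut hL fun b hb => by simp only [hb.imp, hb.sup]; tauto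
      le_sup_right := by
        rintro ⟨s⟩ ⟨t⟩
        exact .taut hL fun b hb => by simp only [hb.imp, hb.sup]; tauto
      sup_le := by
        rintro ⟨s⟩ ⟨t⟩ ⟨r⟩ h h'
        exact .taut₂ hL h h' fun b hb => by simp only [hb.imp, hb.sup]; tauto
      inf_le_left := by
        rintro ⟨s⟩ ⟨t⟩
        exact .taut hL fun b hb => by simp only [hb.imp, hb.meet]; tauto
      inf_le_right := by
        rintro ⟨s⟩ ⟨t⟩
        exact .taut hL fun b hb => by simp only [hb.imp, hb.meet]; tauto
      le_inf := by
        rintro ⟨s⟩ ⟨t⟩ ⟨r⟩ h h'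
        exact .taut₂ hL h h' fun b hb => by simp only [hb.imp, hb.meet]; tauto
      le_sup_inf := by
        rintro ⟨s⟩ ⟨t⟩ ⟨r⟩
        exact .taut hL fun b hb => by simp only [hb.imp, hb.sup, hb.meet]; tauto
      inf_compl_le_bot := by
        rintro ⟨s⟩
        exact .taut hL fun b hb => by simp only [hb.imp, hb.neg, hb.meet]; tauto
      top_le_sup_compl := by
        rintro ⟨s⟩
        exact .taut hL fun b hb => by simp only [hb.imp, hb.neg, hb.sup]; tauto
      le_top := by
        rintro ⟨s⟩
        exact .taut hL fun b hb => by simp only [hb.imp, hb.neg, hb.zero]; tauto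
      bot_le := by
        rintro ⟨s⟩
        exact .taut hL fun b hb => by simp only [hb.imp, hb.zero]; tauto
      sdiff := Quotient.map₂ (fun s t => Tm.meet s (Tm.neg t)) fun s s' h t t' h' =>
        .taut₂ hL h h' fun b hb => by simp only [hb.meet, hb.neg, hb.iff]; tauto
      himp := Quotient.map₂ (fun s t => Tm.sup t (Tm.neg s)) fun s s' h t t' h' =>
        .taut₂ hL h h' fun b hb => by simp only [hb.sup, hb.neg, hb.iff]; tauto
      sdiff_eq := by rintro ⟨s⟩ ⟨t⟩; rfl
      himp_eq := by rintro ⟨s⟩ ⟨t⟩; rfl }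

section Lindenbaum

variable {L : Set Fm} (hL : IsCongruentialLogic L) (Γ : Set Fm)

theorem eval_lindenbaum {α : Type*} (σ : α → Fm) (s : Tm α) :
    s.eval (lindenbaum hL Γ).f (fun i => (⟦σ i⟧ : Quotient (provEquiv hL Γ)))
      = (⟦s.subst σ⟧ : Quotient (provEquiv hL Γ)) := by
  induction s with
  | var i => rfl
  | zero => rfl
  | meet s t hs ht => simp only [Tm.eval, hs, ht]; rfl
  | neg s hs => simp only [Tm.eval, hs]; rfl
  | op s hs => simp only [Tm.eval, hs]; rfl

theorem mk_eq_top_iff (φ : Fm) :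
    (⟦φ⟧ : Quotient (provEquiv hL Γ)) = (⊤ : (lindenbaum hL Γ).carrier) ↔ Entails L Γ φ := by
  refine Quotient.eq.trans ⟨fun h => Entails.taut₁ hL h fun b hb => ?_,
    fun h => Entails.taut₁ hL h fun b hb => ?_⟩ <;>
  · simp only [hb.iff, hb.neg, hb.zero]; tauto

end Lindenbaum

/-! ### The logic of a frame -/

/-- The formulas that take the value `⊤` under every valuation in `A`. -/
def BFrame.logic (A : BFrame.{u}) : Set Fm :=
  {φ | A.Sat φ (Tm.neg Tm.zero)}

theorem BFrame.mem_logic {A : BFrame.{u}} {φ : Fm} :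
    φ ∈ A.logic ↔ ∀ x, φ.eval A.f x = ⊤ := by
  change (∀ x, _ = (⊥ : A.carrier)ᶜ) ↔ _
  rw [compl_bot]

theorem BFrame.iff_mem_logic {A : BFrame.{u}} {s t : Fm} :
    Tm.iff s t ∈ A.logic ↔ A.Sat s t := by
  simp only [mem_logic, Tm.eval_iff_eq_top]; rfl

theorem eval_eq_top_of_isTautology {A : Type u} [BooleanAlgebra A] {φ : Fm} (h : IsTautology φ)
    (f : A → A) (x : ℕ → A) : φ.eval f x = ⊤ := by
  by_contra hne
  -- a prime ideal containing the value of `φ` gives a Boolean valuation that refutes `φ`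
  obtain ⟨I, hI, hle, -⟩ := DistribLattice.prime_ideal_of_disjoint_filter_ideal
    (F := Order.PFilter.principal (⊤ : A)) (I := Order.Ideal.principal (φ.eval f x)) (by
      rw [Set.disjoint_left]
      intro a ha hb
      exact hne (top_le_iff.1 ((Order.PFilter.mem_principal.1 ha).trans
        (Order.Ideal.mem_principal.1 hb))))
  refine h (fun s => s.eval f x ∉ I) ?_ ?_ ?_ (hle (Order.Ideal.mem_principal.2 le_rfl))
  · exact not_not.2 I.bot_mem
  · intro s t
    rw [← not_or, not_iff_not]
    exact ⟨hI.mem_or_mem, fun h => h.elim (I.lower inf_le_left) (I.lower inf_le_right)⟩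
  · intro s
    refine not_congr ⟨hI.toIsProper.notMem_of_compl_mem, hI.compl_mem_of_notMem⟩

theorem BFrame.isCongruentialLogic_logic (A : BFrame.{u}) : IsCongruentialLogic A.logic where
  taut φ h := mem_logic.2 fun x => eval_eq_top_of_isTautology h _ x
  mp φ ψ h h' := mem_logic.2 fun x => by
    have := (Tm.eval_imp_eq_top _ _ _ _).1 (mem_logic.1 h x)
    rwa [mem_logic.1 h' x, top_le_iff] at this
  cong φ ψ h := iff_mem_logic.2 fun x => congrArg A.f (iff_mem_logic.1 h x)
  subst σ φ h := mem_logic.2 fun x => by rw [Tm.eval_subst]; exact mem_logic.1 h _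

/-- Soundness: derivations preserve the value `⊤` in the members of the variety. -/
theorem BFrame.eval_eq_top_of_entails {A : BFrame.{v}} {Γ : Set Fm} {φ : Fm}
    (h : Entails A.logic Γ φ) {B : BFrame.{u}} (hB : B ∈ generatedVariety A)
    {x : ℕ → B.carrier} (hx : ∀ γ ∈ Γ, γ.eval B.f x = ⊤) : φ.eval B.f x = ⊤ := by
  induction h with
  | thm φ hφ => exact (hB _ _ hφ x).trans compl_bot
  | hyp φ hφ => exact hx φ hφ
  | mp φ ψ _ _ h1 h2 =>
    rw [Tm.eval_imp_eq_top, h2, top_le_iff] at h1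
    exact h1
  | cong φ ψ _ h1 =>
    rw [Tm.eval_iff_eq_top] at h1 ⊢
    exact congrArg B.f h1

theorem BFrame.lindenbaum_mem_generatedVariety (A : BFrame.{v}) (Γ : Set Fm) :
    lindenbaum A.isCongruentialLogic_logic Γ ∈ generatedVariety A := by
  intro s t h x
  choose σ hσ using fun i => Quotient.exists_rep (x i)
  obtain rfl : (fun i => (⟦σ i⟧ : Quotient _)) = x := funext hσ
  rw [eval_lindenbaum, eval_lindenbaum]
  exact Quotient.sound (.thm _ (A.isCongruentialLogic_logic.subst σ _ (iff_mem_logic.2 h)))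

/-- Completeness with respect to the variety, in any universe. -/
theorem BFrame.entails_iff {A : BFrame.{0}} {Γ : Set Fm} {φ : Fm} :
    Entails A.logic Γ φ ↔ ∀ B ∈ generatedVariety.{u} A, ∀ x : ℕ → B.carrier,
      (∀ γ ∈ Γ, γ.eval B.f x = ⊤) → φ.eval B.f x = ⊤ := by
  refine ⟨fun h B hB x hx => eval_eq_top_of_entails h hB hx, fun h => ?_⟩
  have hL := A.isCongruentialLogic_logic
  let M := lindenbaum hL Γ
  let x : ℕ → M.carrier := fun i => (⟦Tm.var i⟧ : Quotient (provEquiv hL Γ))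
  have hx : ∀ ψ : Fm, ψ.eval M.f x = ⊤ ↔ Entails A.logic Γ ψ := fun ψ => by
    rw [← mk_eq_top_iff hL]
    change ψ.eval (lindenbaum hL Γ).f (fun i => (⟦Tm.var i⟧ : Quotient (provEquiv hL Γ))) = _ ↔ _
    rw [eval_lindenbaum, Tm.subst_var]
    rfl
  have hd := fun ψ : Fm => M.down_eval_ulift.{u} (fun i => ⟨x i⟩) ψ
  refine (hx φ).1 ((hd φ).symm.trans (congrArg ULift.down (h (BFrame.ulift.{u} M) ?_ _ ?_)))
  · exact fun s t hst => (M.sat_ulift s t).2 (A.lindenbaum_mem_generatedVariety Γ s t hst)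
  · exact fun γ hγ => ULift.down_injective ((hd γ).trans ((hx γ).2 (.hyp γ hγ)))

/-- The defining equation is `x ≈ 1` and the equivalence formula is `x ↔ y`. -/
theorem BFrame.isEquivalentAlgebraicSemantics (A : BFrame.{0}) :
    IsEquivalentAlgebraicSemantics A.logic (generatedVariety.{u} A) := by
  have hτ : ∀ Γ e, e ∈ transform {(Tm.var 0, Tm.neg Tm.zero)} Γ ↔
      ∃ φ ∈ Γ, e = (φ, Tm.neg Tm.zero) := by
    intro Γ e
    simp [transform, Tm.subst]
  refine ⟨{(Tm.var 0, Tm.neg Tm.zero)}, {Tm.iff (Tm.var 0) (Tm.var 1)}, fun Γ φ => ?_,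
    fun s t => ?_⟩
  · have hΓ : ∀ (B : BFrame.{u}) (x : ℕ → B.carrier),
        (∀ d : Fm × Fm, (∃ γ ∈ Γ, d = (γ, Tm.neg Tm.zero)) → d.1.eval B.f x = d.2.eval B.f x) ↔
          ∀ γ ∈ Γ, γ.eval B.f x = ⊤ := fun B x =>
      ⟨fun h γ hγ => (h _ ⟨γ, hγ, rfl⟩).trans compl_bot,
        by rintro h _ ⟨γ, hγ, rfl⟩; exact (h γ hγ).trans compl_bot.symm⟩
    simp only [hτ, entails_iff.{u}, EqEntails, hΓ]
    simp only [Set.mem_singleton_iff, exists_eq_left, forall_eq, Tm.eval, compl_bot]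
  · have hδ : {φ : Fm | ∃ δ ∈ ({Tm.iff (Tm.var 0) (Tm.var 1)} : Finset (Tm (Fin 2))),
        φ = δ.subst ![s, t]} = {Tm.iff s t} := by
      ext φ
      simp [Tm.subst, Tm.iff, Tm.imp]
    rw [hδ]
    simp only [hτ, EqEntails]
    constructor
    · rintro e ⟨φ, rfl, rfl⟩ B - x hx
      simpa [Tm.eval, Tm.eval_iff_eq_top] using hx
    · intro B _ x hx
      simpa [Tm.eval, Tm.eval_iff_eq_top] using hx

/-! ### Maximality and the deduction theorem -/

theorem BFrame.IsSwitching.neg_op_zero_mem {A : BFrame.{u}} (h : A.IsSwitching) :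
    Tm.neg (Tm.op Tm.zero) ∈ A.logic :=
  mem_logic.2 fun _ => by simp only [Tm.eval, h.op_bot, compl_bot]

/-- Over the logic of a switching frame, `φ` yields `box φ`. -/
theorem BFrame.IsSwitching.entails_box {A : BFrame.{u}} (h : A.IsSwitching) {L Γ : Set Fm}
    (hL : IsCongruentialLogic L) (hAL : A.logic ⊆ L) {φ : Fm} (hφ : Entails L Γ φ) :
    Entails L Γ (Tm.box φ) := by
  have h1 : Entails L Γ (Tm.iff (Tm.op (Tm.neg φ)) (Tm.op Tm.zero)) :=
    .cong _ _ (hφ.taut₁ hL fun b hb => by simp only [hb.iff, hb.neg, hb.zero]; tauto)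
  have h2 : Entails L Γ (Tm.neg (Tm.op Tm.zero)) := .thm _ (hAL h.neg_op_zero_mem)
  have h3 := h1.taut₂ hL h2 (χ := Tm.neg (Tm.op (Tm.neg φ))) fun b hb => by
    simp only [hb.iff, hb.neg]; tauto
  exact hφ.taut₂ hL h3 fun b hb => by
    simp only [Tm.box, Tm.sw, hb.sup, hb.neg]; tauto

/-- A formula outside the logic fails at some closed instance `χ`; then `¬ box χ` is a theorem,
while every logic that contains `χ` contains `box χ`. -/
theorem BFrame.isMaximalLogic_logic {A : BFrame.{u}} [Nontrivial A.carrier] (hs : A.IsSwitching)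
    (hg : A.IsTermGenerated) : IsMaximalLogic A.logic := by
  refine ⟨A.isCongruentialLogic_logic, fun h => bot_ne_top (mem_logic.1 h fun _ => ⊥), ?_⟩
  intro L hL h0 hle
  refine Set.Subset.antisymm (fun φ hφ => ?_) hle
  rw [mem_logic]
  intro x
  by_contra hne
  obtain ⟨σ, hσ⟩ := hg.exists_subst x
  let χ : Fm := φ.subst fun i => (σ i).ofClosed
  have hχ : Entails L ∅ (Tm.box χ) := hs.entails_box hL hle (.thm _ (hL.subst _ _ hφ))
  have hn : Tm.neg (Tm.box χ) ∈ L := hle (mem_logic.2 fun y => by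
    have e : χ.eval A.f y = φ.eval A.f x := by
      rw [← hσ, Tm.eval_subst, Tm.eval_subst]
      simp only [Tm.eval_ofClosed]
    simp only [Tm.box, Tm.eval, Tm.eval_sw, e, compl_compl]
    exact hs.sup_op _ fun h => hne (compl_eq_bot.1 h))
  exact h0 ((entails_empty_iff hL).1 (hχ.taut₂ hL (.thm _ hn) fun b hb => by
    simp only [hb.neg]; tauto))

/-- The deduction theorem holds with the formula `box p → q`. -/
theorem BFrame.IsSwitching.hasDDT {A : BFrame.{u}} (hs : A.IsSwitching) : HasDDT A.logic := by
  have hL := A.isCongruentialLogic_logic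
  refine ⟨{Tm.imp (Tm.box (Tm.var 0)) (Tm.var 1)}, fun Γ φ ψ => ?_⟩
  have hI : (∀ χ ∈ ({Tm.imp (Tm.box (Tm.var 0)) (Tm.var 1)} : Finset (Tm (Fin 2))),
      Entails A.logic Γ (χ.subst ![φ, ψ])) ↔ Entails A.logic Γ (Tm.imp (Tm.box φ) ψ) := by
    simp only [Finset.mem_singleton, forall_eq]
    rfl
  rw [hI]
  clear hI
  constructor
  · intro h
    induction h with
    | thm ψ hψ => exact (Entails.thm ψ hψ).taut₁ hL fun b hb => by simp only [hb.imp]; tauto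
    | hyp ψ hψ =>
      rcases hψ with rfl | hψ
      · exact .taut hL fun b hb => by
          simp only [hb.imp, Tm.box, Tm.sw, hb.neg, hb.sup]; tauto
      · exact (Entails.hyp ψ hψ).taut₁ hL fun b hb => by simp only [hb.imp]; tauto
    | mp α β _ _ h1 h2 => exact h1.taut₂ hL h2 fun b hb => by simp only [hb.imp]; tauto
    | cong α β _ h1 =>
      -- `box φ` takes only the values `⊥` and `⊤`, so that `f` may be restricted to it
      have key : ∀ γ : Fm, Entails A.logic Γ (Tm.imp (Tm.box φ)
          (Tm.iff (Tm.op (Tm.meet γ (Tm.box φ))) (Tm.op γ))) := fun γ =>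
        .thm _ (mem_logic.2 fun x => by
          rw [Tm.eval_imp_eq_top]
          have hb : (Tm.box φ).eval A.f x = ⊥ ∨ (Tm.box φ).eval A.f x = ⊤ := by
            simp only [Tm.box, Tm.eval, Tm.eval_sw]
            rcases hs.sw_eq (φ.eval A.f x)ᶜ with e | e <;> simp [e]
          rcases hb with hb | hb
          · rw [hb]; exact bot_le
          · rw [hb, top_le_iff, Tm.eval_iff_eq_top]
            simp only [Tm.eval, hb, inf_top_eq])
      have h2 := Entails.cong (Tm.meet α (Tm.box φ)) (Tm.meet β (Tm.box φ))
        (h1.taut₁ hL fun b hb => by simp only [hb.imp, hb.iff, hb.meet]; tauto)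
      exact ((key α).taut₂ hL (key β) (χ := Tm.imp (Tm.box φ) (Tm.meet
        (Tm.iff (Tm.op (Tm.meet α (Tm.box φ))) (Tm.op α))
        (Tm.iff (Tm.op (Tm.meet β (Tm.box φ))) (Tm.op β))))
        fun b hb => by simp only [hb.imp, hb.meet]; tauto).taut₂ hL h2 fun b hb => by
          simp only [hb.imp, hb.meet, hb.iff]; tauto
  · intro h
    exact .mp _ _ (h.mono (Set.subset_insert φ Γ))
      (hs.entails_box hL Set.Subset.rfl (.hyp φ (Set.mem_insert φ Γ)))

/-! ### The frames on the finite-cofinite algebra -/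

section Frames

variable (S : Set ℕ)

theorem opSet_univ : opSet S Set.univ = {0}ᶜ := if_pos rfl

theorem opSet_empty : opSet S ∅ = ∅ := by
  have h2 : ¬ ∃ n : ℕ, (∅ : Set ℕ) = {n}ᶜ := by
    rintro ⟨n, hn⟩
    have : n + 1 ∈ (∅ : Set ℕ) := by rw [hn]; simp
    exact this
  have h3 : ¬ ∃ n : ℕ, (∅ : Set ℕ) = {n} := by
    rintro ⟨n, hn⟩
    exact Set.singleton_ne_empty n hn.symm
  have h4 : ¬ ∃ n : ℕ, 1 ≤ n ∧ n ∈ S ∧ (∅ : Set ℕ) = Set.Iic n := by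
    rintro ⟨n, -, -, hn⟩
    exact Set.nonempty_Iic.ne_empty hn.symm
  rw [opSet, if_neg Set.empty_ne_univ, dif_neg h2, if_neg h3, if_neg h4, if_pos rfl]

theorem opSet_compl_singleton (n : ℕ) : opSet S {n}ᶜ = {n + 1}ᶜ := by
  have h1 : ({n}ᶜ : Set ℕ) ≠ Set.univ := by simp
  have h2 : ∃ m : ℕ, ({n}ᶜ : Set ℕ) = {m}ᶜ := ⟨n, rfl⟩
  rw [opSet, if_neg h1, dif_pos h2,
    ← Set.singleton_injective (compl_injective h2.choose_spec)]

theorem union_opSet {X : Set ℕ} (hX : X ≠ ∅) : X ∪ opSet S X = Set.univ := by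
  by_cases h : ∃ n : ℕ, X = {n}ᶜ
  · obtain ⟨n, rfl⟩ := h
    rw [opSet_compl_singleton, ← Set.compl_inter, Set.compl_univ_iff]
    simp
  · unfold opSet
    rw [dif_neg h]
    split_ifs with h1
    · rw [h1, Set.univ_union]
    · exact Set.union_compl_self X
    · exact Set.union_compl_self X
    · exact Set.union_univ X

/-- For `n ≥ 1` the set `{0, …, n}` is neither empty, an atom, a co-atom nor everything, so that
the value at it tells whether `n ∈ S`. -/
theorem opSet_Iic_eq_compl_iff {n : ℕ} (hn : 1 ≤ n) :
    opSet S (Set.Iic n) = (Set.Iic n)ᶜ ↔ n ∈ S := by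
  have h1 : Set.Iic n ≠ Set.univ := fun h => by
    have : n + 1 ∈ Set.Iic n := h ▸ Set.mem_univ _
    simp at this
  have h2 : ¬ ∃ m : ℕ, Set.Iic n = {m}ᶜ := by
    rintro ⟨m, hm⟩
    have : n + m + 1 ∈ Set.Iic n := by rw [hm]; simp; omega
    simp at this
  have h3 : ¬ ∃ m : ℕ, Set.Iic n = {m} := by
    rintro ⟨m, hm⟩
    have e0 : 0 ∈ ({m} : Set ℕ) := hm ▸ Nat.zero_le n
    have e1 : 1 ∈ ({m} : Set ℕ) := hm ▸ hn
    simp at e0 e1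
    omega
  rw [opSet, if_neg h1, dif_neg h2, if_neg h3]
  by_cases hS : n ∈ S
  · rw [if_pos ⟨n, hn, hS, rfl⟩]
    simp [hS]
  · have h4 : ¬ ∃ m : ℕ, 1 ≤ m ∧ m ∈ S ∧ Set.Iic n = Set.Iic m := by
      rintro ⟨m, -, hm, e⟩
      exact hS (Set.Iic_injective e ▸ hm)
    rw [if_neg h4, if_neg Set.nonempty_Iic.ne_empty]
    refine iff_of_false (fun h => ?_) hS
    have : 0 ∈ (Set.Iic n)ᶜ := h ▸ Set.mem_univ 0
    simp at this

/-- The underlying set of natural numbers of an element of `frameOf S`. -/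
def toSet (a : (frameOf S).carrier) : Set ℕ := a.1

theorem toSet_injective : Function.Injective (toSet S) := Subtype.val_injective

theorem isSwitching_frameOf : (frameOf S).IsSwitching where
  op_bot := toSet_injective S (opSet_empty S)
  sup_op _ hx := toSet_injective S (union_opSet S fun h => hx (toSet_injective S h))

theorem op_top_ne_bot : (frameOf S).f ⊤ ≠ ⊥ := fun h => by
  have : ({0}ᶜ : Set ℕ) = ∅ := (opSet_univ S).symm.trans (congrArg (toSet S) h)
  have h1 : 1 ∈ ({0}ᶜ : Set ℕ) := by simp
  rw [this] at h1
  exact h1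

theorem op_top_ne_top : (frameOf S).f ⊤ ≠ ⊤ := fun h => by
  have : ({0}ᶜ : Set ℕ) = Set.univ := (opSet_univ S).symm.trans (congrArg (toSet S) h)
  simp at this

instance nontrivial_frameOf : Nontrivial (frameOf S).carrier := ⟨_, _, op_top_ne_top S⟩

end Frames

/-- The value of a closed term in `frameOf S`, as a set. -/
noncomputable def closedVal (S : Set ℕ) (c : Tm Empty) : Set ℕ :=
  toSet S (c.eval (frameOf S).f Empty.elim)

theorem closedVal_neg (S : Set ℕ) (c : Tm Empty) :
    closedVal S (Tm.neg c) = (closedVal S c)ᶜ := rfl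

theorem closedVal_op (S : Set ℕ) (c : Tm Empty) :
    closedVal S (Tm.op c) = opSet S (closedVal S c) := rfl

theorem closedVal_sup (S : Set ℕ) (c d : Tm Empty) :
    closedVal S (Tm.sup c d) = closedVal S c ∪ closedVal S d := by
  rw [closedVal, Tm.eval_sup]; rfl

theorem exists_closedVal_eq_compl_singleton (n : ℕ) :
    ∃ c : Tm Empty, ∀ S, closedVal S c = {n}ᶜ := by
  induction n with
  | zero =>
    refine ⟨Tm.op (Tm.neg Tm.zero), fun S => ?_⟩
    rw [closedVal_op, closedVal_neg, ← opSet_univ S, ← Set.compl_empty]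
    rfl
  | succ n ih =>
    obtain ⟨c, hc⟩ := ih
    exact ⟨Tm.op c, fun S => by rw [closedVal_op, hc, opSet_compl_singleton]⟩

/-- Every finite set is denoted by a closed term that is the same for all `S`. -/
theorem exists_closedVal_eq_of_finite {X : Set ℕ} (hX : X.Finite) :
    ∃ c : Tm Empty, ∀ S, closedVal S c = X := by
  induction X, hX using Set.Finite.induction_on with
  | empty => exact ⟨Tm.zero, fun S => rfl⟩
  | @insert n X _ _ ih =>
    obtain ⟨c, hc⟩ := ih
    obtain ⟨d, hd⟩ := exists_closedVal_eq_compl_singleton n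
    refine ⟨Tm.sup (Tm.neg d) c, fun S => ?_⟩
    rw [closedVal_sup, closedVal_neg, hc, hd, compl_compl, Set.insert_eq]

theorem isTermGenerated_frameOf (S : Set ℕ) : (frameOf S).IsTermGenerated := by
  intro a
  rcases (a.2 : (toSet S a).Finite ∨ (toSet S a)ᶜ.Finite) with h | h
  · obtain ⟨c, hc⟩ := exists_closedVal_eq_of_finite h
    exact ⟨c, toSet_injective S (hc S)⟩
  · obtain ⟨c, hc⟩ := exists_closedVal_eq_of_finite h
    refine ⟨Tm.neg c, toSet_injective S ?_⟩
    change closedVal S (Tm.neg c) = _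
    rw [closedVal_neg, hc, compl_compl]
    rfl

/-- For each `n ≥ 1` the closed equation `f u_n ≈ - u_n` holds in `frameOf S` iff `n ∈ S`. -/
theorem exists_sat_iff_mem {n : ℕ} (hn : 1 ≤ n) :
    ∃ s t : Fm, ∀ S, (frameOf S).Sat s t ↔ n ∈ S := by
  obtain ⟨c, hc⟩ := exists_closedVal_eq_of_finite (Set.finite_Iic n)
  refine ⟨(Tm.op c).ofClosed, (Tm.neg c).ofClosed, fun S => ?_⟩
  rw [← opSet_Iic_eq_compl_iff S hn, ← hc S, ← closedVal_op, ← closedVal_neg]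
  simp only [BFrame.Sat, Tm.eval_ofClosed, forall_const]
  exact (toSet_injective S).eq_iff.symm

theorem eq_of_sat_iff {S T : Set ℕ} (hS : 0 ∉ S) (hT : 0 ∉ T)
    (h : ∀ s t, (frameOf S).Sat s t ↔ (frameOf T).Sat s t) : S = T := by
  ext n
  rcases Nat.eq_zero_or_pos n with rfl | hn
  · exact iff_of_false hS hT
  · obtain ⟨s, t, hst⟩ := exists_sat_iff_mem hn
    rw [← hst S, ← hst T, h]

theorem injOn_varietyOf : Set.InjOn (fun S : Set ℕ => varietyOf.{u} S) {S | 0 ∉ S} := by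
  have key : ∀ S T : Set ℕ, varietyOf.{u} S = varietyOf.{u} T →
      ∀ s t, (frameOf T).Sat s t → (frameOf S).Sat s t := by
    intro S T h s t hT
    have hm : (frameOf S).ulift ∈ varietyOf.{u} T :=
      h ▸ BFrame.ulift_mem_generatedVariety.{u} (frameOf S)
    exact (BFrame.sat_ulift _ s t).1 (hm s t hT)
  intro S hS T hT h
  exact eq_of_sat_iff hS hT fun s t => ⟨key T S h.symm s t, key S T h s t⟩

theorem injOn_logicOf : Set.InjOn logicOf {S | 0 ∉ S} := by
  intro S hS T hT h
  refine eq_of_sat_iff hS hT fun s t => ?_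
  rw [← BFrame.iff_mem_logic, ← BFrame.iff_mem_logic]
  exact Set.ext_iff.1 h _

/-! ### Counting -/

/-- The positive shifts of the subsets of `ℕ` index continuum many different objects, and there are
only continuum many sets of pairs of formulas. -/
theorem mk_eq_continuum {α : Type v} {P : α → Prop} {F : Set ℕ → α}
    (hF : Set.InjOn F {S | 0 ∉ S}) (hP : ∀ S, 0 ∉ S → P (F S))
    {G : α → Set (Fm × Fm)} (hG : Set.InjOn G {a | P a}) :
    Cardinal.mk {a // P a} = Cardinal.continuum := by
  have h0 : ∀ T : Set ℕ, 0 ∉ Nat.succ '' T := fun T => by simp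
  apply le_antisymm
  · have := Cardinal.mk_le_of_injective (α := ULift.{0} {a // P a})
      (β := ULift.{v} (Set (Fm × Fm))) (f := fun a => ⟨G a.down.1⟩) fun a b h =>
        ULift.down_injective (Subtype.ext (hG a.down.2 b.down.2 (congrArg ULift.down h)))
    rw [Cardinal.mk_uLift, Cardinal.mk_uLift, Cardinal.lift_uzero, Cardinal.mk_set,
      Cardinal.lift_power, Cardinal.lift_two] at this
    refine this.trans ?_
    rw [← Cardinal.two_power_aleph0]
    exact Cardinal.power_le_power_left two_ne_zero
      ((Cardinal.lift_le_aleph0).2 (Cardinal.mk_le_aleph0))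
  · have := Cardinal.mk_le_of_injective (α := ULift.{v} (Set ℕ)) (β := {a // P a})
      (f := fun T => ⟨F (Nat.succ '' T.down), hP _ (h0 _)⟩) fun T T' h =>
        ULift.down_injective (Set.image_injective.2 Nat.succ_injective
          (hF (h0 _) (h0 _) (congrArg Subtype.val h)))
    rwa [Cardinal.mk_uLift, Cardinal.mk_set_nat, Cardinal.lift_continuum] at this

/-- A variety is determined by the equations valid in it. -/
theorem injOn_equations :
    Set.InjOn (fun V : Set BFrame.{u} => {e : Fm × Fm | ∀ A ∈ V, A.Sat e.1 e.2})
      {V | IsVariety V} := by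
  have key : ∀ V W : Set BFrame.{u}, IsVariety W →
      {e : Fm × Fm | ∀ A ∈ V, A.Sat e.1 e.2} = {e : Fm × Fm | ∀ A ∈ W, A.Sat e.1 e.2} →
      V ⊆ W := by
    rintro V W ⟨E, rfl⟩ h A hA e he
    have : e ∈ {e : Fm × Fm | ∀ A ∈ V, A.Sat e.1 e.2} := h ▸ fun B hB => hB e he
    exact this A hA
  exact fun V hV W hW h => (key V W hW h).antisymm (key W V hV h.symm)

theorem mk_varieties_eq_continuum {P : Set BFrame.{u} → Prop}
    (hP : ∀ S, 0 ∉ S → P (varietyOf.{u} S)) (hV : ∀ V, P V → IsVariety V) :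
    Cardinal.mk {V // P V} = Cardinal.continuum :=
  mk_eq_continuum injOn_varietyOf hP (injOn_equations.mono hV)

theorem mk_logics_eq_continuum {P : Set Fm → Prop} (hP : ∀ S, 0 ∉ S → P (logicOf S)) :
    Cardinal.mk {L // P L} = Cardinal.continuum :=
  mk_eq_continuum injOn_logicOf hP (G := fun L => (fun φ => (φ, φ)) '' L)
    (Set.image_injective.2 fun _ _ h => congrArg Prod.fst h).injOn

end BoolFrames

open BoolFrames in
theorem mainTheorem1 :
    -- the varieties
    (∀ S : Set ℕ, 0 ∉ S →
      IsMinimalVariety (varietyOf.{u} S) ∧ IsDiscriminatorVariety (varietyOf.{u} S) ∧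
      StronglyNonAdditive (varietyOf.{u} S) ∧ StronglyNonMonotone (varietyOf.{u} S)) ∧
    Set.InjOn (fun S : Set ℕ => varietyOf.{u} S) {S | 0 ∉ S} ∧
    Cardinal.mk {V : Set BFrame.{u} // IsMinimalVariety V ∧ IsDiscriminatorVariety V ∧
      StronglyNonAdditive V} = Cardinal.continuum ∧
    Cardinal.mk {V : Set BFrame.{u} // IsMinimalVariety V ∧ IsDiscriminatorVariety V ∧
      StronglyNonMonotone V} = Cardinal.continuum ∧
    -- the logics
    (∀ S : Set ℕ, 0 ∉ S →
      IsEquivalentAlgebraicSemantics (logicOf S) (varietyOf.{u} S) ∧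
      IsMaximalLogic (logicOf S) ∧ HasDDT (logicOf S) ∧
      IsStronglyNonAdditiveLogic.{u} (logicOf S) ∧
      IsStronglyNonMonotoneLogic.{u} (logicOf S)) ∧
    Set.InjOn logicOf {S | 0 ∉ S} ∧
    Cardinal.mk {L : Set Fm // IsMaximalLogic L ∧ HasDDT L ∧
      IsStronglyNonAdditiveLogic.{u} L} = Cardinal.continuum ∧
    Cardinal.mk {L : Set Fm // IsMaximalLogic L ∧ HasDDT L ∧
      IsStronglyNonMonotoneLogic.{u} L} = Cardinal.continuum := by
  have hmin (S : Set ℕ) : IsMinimalVariety (varietyOf.{u} S) :=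
    isMinimalVariety_generatedVariety.{u, 0} (isSwitching_frameOf S) (isTermGenerated_frameOf S)
  have hdis (S : Set ℕ) : IsDiscriminatorVariety (varietyOf.{u} S) :=
    (isSwitching_frameOf S).isDiscriminatorVariety
  have hmon (S : Set ℕ) : StronglyNonMonotone (varietyOf.{u} S) :=
    BFrame.IsSwitching.stronglyNonMonotone.{u, 0} (isSwitching_frameOf S) (op_top_ne_bot S)
      (op_top_ne_top S)
  have hadd (S : Set ℕ) : StronglyNonAdditive (varietyOf.{u} S) := (hmon S).stronglyNonAdditive
  have halg (S : Set ℕ) : IsEquivalentAlgebraicSemantics (logicOf S) (varietyOf.{u} S) :=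
    (frameOf S).isEquivalentAlgebraicSemantics
  have hmax (S : Set ℕ) : IsMaximalLogic (logicOf S) :=
    BFrame.isMaximalLogic_logic (isSwitching_frameOf S) (isTermGenerated_frameOf S)
  have hddt (S : Set ℕ) : HasDDT (logicOf S) := (isSwitching_frameOf S).hasDDT
  have hladd (S : Set ℕ) : IsStronglyNonAdditiveLogic.{u} (logicOf S) :=
    ⟨_, (hmin S).1, halg S, hadd S⟩
  have hlmon (S : Set ℕ) : IsStronglyNonMonotoneLogic.{u} (logicOf S) :=
    ⟨_, (hmin S).1, halg S, hmon S⟩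
  exact ⟨fun S _ => ⟨hmin S, hdis S, hadd S, hmon S⟩, injOn_varietyOf,
    mk_varieties_eq_continuum (fun S _ => ⟨hmin S, hdis S, hadd S⟩) fun V h => h.1.1,
    mk_varieties_eq_continuum (fun S _ => ⟨hmin S, hdis S, hmon S⟩) fun V h => h.1.1,
    fun S _ => ⟨halg S, hmax S, hddt S, hladd S, hlmon S⟩, injOn_logicOf,
    mk_logics_eq_continuum fun S _ => ⟨hmax S, hddt S, hladd S⟩,
    mk_logics_eq_continuum fun S _ => ⟨hmax S, hddt S, hlmon S⟩⟩
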